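/- Let $d\geq 2$ be even and let $\Gamma_1,\dots,\Gamma_d$ be self-adjoint complex matrices forming an irreducible representation of the complex Clifford algebra with $d$ generators, i.e. $\Gamma_i\Gamma_j+\Gamma_j\Gamma_i=2\delta_{ij}\mathbf 1$, with a non-zero representation space that has no non-trivial common invariant subspace. Put $\Gamma_0=(-\imath)^{d/2}\,\Gamma_1\cdots\Gamma_d$. Let $b=(b_1,\dots,b_d)\in\mathbb R^d$ and $m\in\mathbb R\setminus\{0\}$. For $k\in\mathbb R^d$ let $$ P_k(m)\;=\;\chi\big(H_k+m\Gamma_0<0\big)\,,\qquad H_k\;=\;\sum_{j=1}^d b_jk_j\Gamma_j\,, $$ be the spectral projection of the massive Dirac Hamiltonian $H_k+m\Gamma_0$ onto its negative spectrum. Then $k\in\mathbb R^d\mapsto P_k(m)$ is differentiable, the function $$ k\;\mapsto\;\sum_{\rho\in\mathcal S_d}(-1)^\rho\,\mathrm{Tr}\Big(P_k(m)\prod_{j=1}^d\partial_{k_{\rho(j)}}P_k(m)\Big) $$ (product taken in the order $j=1,\dots,d$) is Lebesgue integrable on $\mathbb R^d$, and the $d$-th Chern integral $$ \mathrm C_d(P(m))\;=\;\frac{(2\imath\pi)^{d/2}}{(d/2)!}\int_{\mathbb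 R^d}\frac{dk}{(2\pi)^d}\;\sum_{\rho\in\mathcal S_d}(-1)^\rho\,\mathrm{Tr}\Big(P_k(m)\prod_{j=1}^d\partial_{k_{\rho(j)}}P_k(m)\Big) $$ is equal to $$ \mathrm C_d(P(m))\;=\;\tfrac12\,(-1)^{\frac d2+1}\,\mathrm{sgn}(b)\,\mathrm{sgn}(m)\,,\qquad \mathrm{sgn}(b)=\prod_{j=1}^d\mathrm{sgn}(b_j)\,, $$ with the convention $\mathrm{sgn}(0)=0$. -/

import Mathlib

open scoped Matrix

noncomputable section

/-- `Γ_1, …, Γ_d` are (the images of the generators under) an irreducible representation, by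
self-adjoint matrices, of the complex Clifford algebra with `d` generators:
`Γ_i Γ_j + Γ_j Γ_i = 2 δ_{ij}`, the representation space is non-zero and it has no invariant
subspaces except for the trivial ones. -/
structure IsIrreducibleCliffordRep {d : ℕ} {n : Type*} [Fintype n] [DecidableEq n]
    (Γ : Fin d → Matrix n n ℂ) : Prop where
  isHermitian : ∀ j, (Γ j).IsHermitian
  sq_eq_one : ∀ j, Γ j * Γ j = 1
  anticomm : ∀ i j, i ≠ j → Γ i * Γ j = -(Γ j * Γ i)
  nonempty : Nonempty n
  irreducible : ∀ W : Submodule ℂ (n → ℂ),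
    (∀ j, ∀ v ∈ W, Γ j *ᵥ v ∈ W) → W = ⊥ ∨ W = ⊤

/-- The chirality matrix `Γ_0 = (-i)^{d/2} Γ_1 ⋯ Γ_d` (used for even `d`). -/
def chiralityMatrix {d : ℕ} {n : Type*} [Fintype n] [DecidableEq n]
    (Γ : Fin d → Matrix n n ℂ) : Matrix n n ℂ :=
  (-Complex.I) ^ (d / 2) • (List.ofFn Γ).prod

/-- The Dirac Hamiltonian `H_k = ∑_j b_j k_j Γ_j`. -/
def diracHamiltonian {d : ℕ} {n : Type*}
    (Γ : Fin d → Matrix n n ℂ) (b k : Fin d → ℝ) : Matrix n n ℂ :=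
  ∑ j, ((b j * k j : ℝ) : ℂ) • Γ j

/-- The massive Dirac Hamiltonian `H_k + m Γ_0`. -/
def massiveDiracHamiltonian {d : ℕ} {n : Type*} [Fintype n] [DecidableEq n]
    (Γ : Fin d → Matrix n n ℂ) (b : Fin d → ℝ) (m : ℝ) (k : Fin d → ℝ) : Matrix n n ℂ :=
  diracHamiltonian Γ b k + (m : ℂ) • chiralityMatrix Γ

/-- The spectral projection `χ(A < 0)` of a self-adjoint matrix onto its negative spectrum,
through the functional calculus (every function is continuous on the finite spectrum). -/
def negativeSpectralProjection {n : Type*} [Fintype n] [DecidableEq n]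
    (A : Matrix n n ℂ) : Matrix n n ℂ :=
  cfc (Set.indicator (Set.Iio (0 : ℝ)) (fun _ => (1 : ℝ))) A

/-- The family of projections `P_k(m) = χ(H_k + m Γ_0 < 0)`. -/
def diracProjection {d : ℕ} {n : Type*} [Fintype n] [DecidableEq n]
    (Γ : Fin d → Matrix n n ℂ) (b : Fin d → ℝ) (m : ℝ) (k : Fin d → ℝ) : Matrix n n ℂ :=
  negativeSpectralProjection (massiveDiracHamiltonian Γ b m k)

/-- The partial derivative `∂_{k_j} P_k` of a matrix-valued function on `ℝ^d`, entry by entry. -/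
def matrixPartialDeriv {d : ℕ} {n : Type*}
    (P : (Fin d → ℝ) → Matrix n n ℂ) (j : Fin d) (k : Fin d → ℝ) : Matrix n n ℂ :=
  Matrix.of fun r s => deriv (fun t : ℝ => P (Function.update k j t) r s) (k j)

/-- The density `∑_ρ (-1)^ρ Tr (P_k ∂_{k_ρ(1)} P_k ⋯ ∂_{k_ρ(d)} P_k)` of the differential form
`Tr (P (dP)^{∧ d})`. -/
def chernDensity {d : ℕ} {n : Type*} [Fintype n] [DecidableEq n]
    (P : (Fin d → ℝ) → Matrix n n ℂ) (k : Fin d → ℝ) : ℂ :=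
  ∑ ρ : Equiv.Perm (Fin d), ((Equiv.Perm.sign ρ : ℤ) : ℂ) *
    (P k * (List.ofFn fun j => matrixPartialDeriv P (ρ j) k).prod).trace

/-- The `d`-th Chern integral
`(2πi)^{d/2} / (d/2)! ∫_{ℝ^d} dk/(2π)^d ∑_ρ (-1)^ρ Tr (P_k ∏_j ∂_{k_ρ(j)} P_k)`, for even `d`. -/
def chernIntegral {d : ℕ} {n : Type*} [Fintype n] [DecidableEq n]
    (P : (Fin d → ℝ) → Matrix n n ℂ) : ℂ :=
  (2 * Complex.I * (Real.pi : ℂ)) ^ (d / 2) / ((d / 2).factorial : ℂ) *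
    ∫ k : Fin d → ℝ, chernDensity P k / (2 * (Real.pi : ℂ)) ^ d

end

/-! Write `H` for the massive Hamiltonian at `k` and `E ^ 2 = ∑ (b_j k_j) ^ 2 + m ^ 2`. The Clifford
relations give `H ^ 2 = E ^ 2`, so `P = (1 - H / E) / 2` and `∂_j P = -V_j / 2`, where `V_j` is
`(b_j / E) Γ_j` plus a multiple of `H`, and `H` anticommutes with `V_j`.

The density is an alternating form in the derivatives (`alternatingTrace`), so it simplifies
algebraically. The summand `1` of `P` contributes nothing, by cyclicity of the trace
(`alternatingTrace_one`), and the multiples of `H` may be dropped from the `V_j`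
(`alternatingTrace_add_smul`). There remains `d! ∏ (b_j / E) Tr (H Γ_1 ⋯ Γ_d)`, in which only the
mass term of `H` has a non-zero trace; its value needs the dimension `2 ^ (d / 2)` of the
representation (`card_eq`).

The density is thus a constant times `E ^ (-(d + 1))`. A Gamma integral turns this power into
Gaussians (`integral_rpow_neg_add_half`), and the duplication formula at half-integers cancels the
remaining factorials. -/

/-! ### Signs in ordered products and vanishing traces -/

theorem mul_prod_ofFn_of_sign_comm {A : Type*} [Ring A] {d : ℕ} (M : A) (X : Fin d → A)
    (ε : Fin d → ℤ) (h : ∀ i, M * X i = ε i • (X i * M)) :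
    M * (List.ofFn X).prod = (∏ i, ε i) • ((List.ofFn X).prod * M) := by
  induction d with
  | zero => simp
  | succ d ih =>
    have h2 := ih (fun i => X i.succ) (fun i => ε i.succ) (fun i => h i.succ)
    rw [List.ofFn_succ, List.prod_cons, ← mul_assoc, h 0, smul_mul_assoc, mul_assoc, h2,
      Fin.prod_univ_succ, mul_smul_comm, smul_smul, mul_assoc]

theorem prod_ite_eq_one_neg_one {d : ℕ} (hd : Even d) (j : Fin d) :
    ∏ i, (if i = j then (1 : ℤ) else -1) = -1 := by
  -- The complementary product has the single factor `-1`, and the two together multiply to `(-1) ^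
  -- d = 1`.
  have h1 : (∏ i, (if i = j then (1 : ℤ) else -1)) * ∏ i, (if i = j then (-1 : ℤ) else 1) = 1 := by
    rw [← Finset.prod_mul_distrib]
    have : ∀ i : Fin d, ((if i = j then (1 : ℤ) else -1) * if i = j then (-1 : ℤ) else 1) = -1 := by
      intro i; split_ifs <;> rfl
    simp [this, hd.neg_one_pow]
  rw [Finset.prod_ite_eq' Finset.univ j (fun _ => (-1 : ℤ))] at h1
  simp only [Finset.mem_univ, if_true] at h1
  omega

theorem mul_prod_ofFn_of_anticomm {A : Type*} [Ring A] {d : ℕ} (hd : Even d) (M : A)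
    (X : Fin d → A) (j : Fin d) (hj : M * X j = X j * M)
    (h : ∀ i, i ≠ j → M * X i = -(X i * M)) :
    M * (List.ofFn X).prod = -((List.ofFn X).prod * M) := by
  rw [mul_prod_ofFn_of_sign_comm M X (fun i => if i = j then 1 else -1),
    prod_ite_eq_one_neg_one hd, neg_one_smul]
  intro i
  by_cases hi : i = j
  · subst hi; simp [hj]
  · simp [hi, h i hi]

theorem prod_ofFn_comp_swap {A : Type*} [Ring A] {d : ℕ} (f : Fin (d + 1) → A) (i : Fin d)
    (h : f i.castSucc * f i.succ = -(f i.succ * f i.castSucc)) :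
    (List.ofFn (f ∘ Equiv.swap i.castSucc i.succ)).prod = -(List.ofFn f).prod := by
  induction d with
  | zero => exact i.elim0
  | succ d ih =>
    cases i using Fin.cases with
    | zero =>
      have hs : ∀ j : Fin d, Equiv.swap (0 : Fin (d + 2)) 1 j.succ.succ = j.succ.succ := by
        intro j
        apply Equiv.swap_apply_of_ne_of_ne
        · exact Fin.succ_ne_zero _
        · simp [Fin.ext_iff]
      simp only [Fin.castSucc_zero, Fin.succ_zero_eq_one] at h
      simp only [List.ofFn_succ, List.prod_cons, Function.comp_apply, Fin.castSucc_zero,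
        Fin.succ_zero_eq_one, Equiv.swap_apply_left, Equiv.swap_apply_right, hs]
      rw [← mul_assoc, ← mul_assoc, h, neg_mul, neg_neg]
    | succ i =>
      have := ih (fun j => f j.succ) i (by simpa using h)
      rw [List.ofFn_succ, List.prod_cons, List.ofFn_succ (f := f), List.prod_cons]
      have h0 : (f ∘ Equiv.swap i.succ.castSucc i.succ.succ) 0 = f 0 := by
        simp only [Function.comp_apply]
        rw [Equiv.swap_apply_of_ne_of_ne]
        · simp [Fin.ext_iff]
        · exact (Fin.succ_ne_zero _).symm
      have h1 : (fun j : Fin (d + 1) => (f ∘ Equiv.swap i.succ.castSucc i.succ.succ) j.succ)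
          = (fun j => f j.succ) ∘ Equiv.swap i.castSucc i.succ := by
        funext j
        simp only [Function.comp_apply]
        rw [(Fin.succ_injective (d + 1)).map_swap]
        simp
      rw [h0, h1, this, mul_neg]

/-- Adjacent transpositions generate the symmetric group. Appending them on the right exchanges
neighbouring positions of the product, whatever factors stand there. -/
theorem prod_ofFn_comp_perm {A : Type*} [Ring A] {d : ℕ} (f : Fin d → A)
    (h : ∀ i j, i ≠ j → f i * f j = -(f j * f i)) (ρ : Equiv.Perm (Fin d)) :
    (List.ofFn (f ∘ ρ)).prod = (Equiv.Perm.sign ρ : ℤ) • (List.ofFn f).prod := by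
  cases d with
  | zero => simp [Subsingleton.elim ρ 1]
  | succ d =>
    have hρ : ρ ∈ Submonoid.closure
        (Set.range fun i : Fin d => Equiv.swap i.castSucc i.succ) := by
      rw [Equiv.Perm.mclosure_swap_castSucc_succ]; trivial
    induction hρ using Submonoid.closure_induction_right with
    | one => simp
    | mul_right σ _ τ hτ ih =>
      obtain ⟨i, rfl⟩ := hτ
      have hne : i.castSucc ≠ i.succ := by simp [Fin.ext_iff]
      rw [Equiv.Perm.coe_mul, ← Function.comp_assoc, prod_ofFn_comp_swap, ih]
      · simp [Equiv.Perm.sign_swap hne]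
      · exact h _ _ (fun e => hne (σ.injective e))

theorem Matrix.trace_eq_zero_of_anticomm {n : Type*} [Fintype n] [DecidableEq n]
    {M X : Matrix n n ℂ} (hM : M * M = 1) (h : M * X = -(X * M)) : X.trace = 0 := by
  have h1 : X.trace = -X.trace := by
    calc X.trace = (M * M * X).trace := by rw [hM, one_mul]
      _ = (M * (M * X)).trace := by rw [mul_assoc]
      _ = -(M * (X * M)).trace := by rw [h, mul_neg, Matrix.trace_neg]
      _ = -X.trace := by rw [Matrix.trace_mul_comm, mul_assoc, hM, mul_one]
  exact self_eq_neg.mp h1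

theorem Matrix.trace_mul_eq_zero_of_anticomm {n : Type*} [Fintype n]
    {M X : Matrix n n ℂ} (h : M * X = -(X * M)) : (M * X).trace = 0 := by
  have h1 : (M * X).trace = -(M * X).trace := by
    conv_lhs => rw [h, Matrix.trace_neg, Matrix.trace_mul_comm]
  exact self_eq_neg.mp h1

/-! ### Clifford monomials and the dimension of the representation -/

/-- The ordered product of those `X i` with `s i = true`. -/
def orderedMonomial {A : Type*} [Monoid A] {d : ℕ} (X : Fin d → A) (s : Fin d → Bool) : A :=
  (List.ofFn fun i => if s i then X i else 1).prod

/-- Moving `X j` to its place costs only a sign. The sign stays unspecified because it cancels in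
the averages `∑ G s * A * (G s)ᴴ` of `card_sq`. -/
theorem mul_orderedMonomial {A : Type*} [Ring A] {d : ℕ} (X : Fin d → A)
    (hsq : ∀ i, X i * X i = 1) (h : ∀ i j, i ≠ j → X i * X j = -(X j * X i))
    (j : Fin d) (s : Fin d → Bool) :
    X j * orderedMonomial X s = orderedMonomial X (Function.update s j (!s j)) ∨
    X j * orderedMonomial X s = -orderedMonomial X (Function.update s j (!s j)) := by
  induction d with
  | zero => exact j.elim0
  | succ d ih =>
    cases j using Fin.cases with
    | zero =>
      left
      unfold orderedMonomial
      rw [List.ofFn_succ, List.prod_cons, List.ofFn_succ, List.prod_cons, ← mul_assoc]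
      congr 1
      cases hs : s 0 <;> simp [hsq]
    | succ j =>
      have key : orderedMonomial X (Function.update s j.succ (!s j.succ)) =
          (if s 0 then X 0 else 1) * orderedMonomial (fun i => X i.succ)
            (Function.update (fun i => s i.succ) j (!s j.succ)) := by
        unfold orderedMonomial
        rw [List.ofFn_succ, List.prod_cons]
        rw [Function.update_of_ne (Fin.succ_ne_zero j).symm]
        · congr 2
          refine congrArg List.ofFn (funext fun i => ?_)
          by_cases hi : i = j
          · subst hi; simp
          · rw [Function.update_of_ne hi, Function.update_of_ne
              (fun e => hi (Fin.succ_injective _ e))]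
      have key2 : orderedMonomial X s =
          (if s 0 then X 0 else 1) * orderedMonomial (fun i => X i.succ) (fun i => s i.succ) := by
        unfold orderedMonomial
        rw [List.ofFn_succ, List.prod_cons]
      have hI := ih (fun i => X i.succ) (fun i => hsq _)
        (fun i j hij => h _ _ (fun e => hij (Fin.succ_injective _ e))) j (fun i => s i.succ)
      have hc : X j.succ * (if s 0 then X 0 else 1) = (if s 0 then X 0 else 1) * X j.succ ∨
          X j.succ * (if s 0 then X 0 else 1) = -((if s 0 then X 0 else 1) * X j.succ) := by
        cases s 0
        · left; simp
        · right; simpa using h _ _ (Fin.succ_ne_zero j)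
      rw [key, key2, ← mul_assoc]
      rcases hc with hc | hc <;> rcases hI with hI | hI <;> rw [hc] <;>
        simp only [neg_mul, mul_assoc, hI, mul_neg, neg_neg, true_or, or_true]

namespace IsIrreducibleCliffordRep

variable {d : ℕ} {n : Type*} [Fintype n] [DecidableEq n] {Γ : Fin d → Matrix n n ℂ}

/-- Schur's lemma: an eigenspace of `T` is invariant and non-zero, hence everything. -/
theorem eq_smul_one_of_commute (hΓ : IsIrreducibleCliffordRep Γ) (T : Matrix n n ℂ)
    (hT : ∀ j, Γ j * T = T * Γ j) : ∃ c : ℂ, T = c • 1 := by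
  have := hΓ.nonempty
  obtain ⟨c, hc⟩ := Module.End.exists_eigenvalue (Matrix.toLin' T)
  refine ⟨c, ?_⟩
  have htop : Module.End.eigenspace (Matrix.toLin' T) c = ⊤ := by
    refine (hΓ.irreducible (Module.End.eigenspace (Matrix.toLin' T) c) ?_).resolve_left hc
    intro j v hv
    rw [Module.End.mem_eigenspace_iff, Matrix.toLin'_apply] at hv ⊢
    rw [Matrix.mulVec_mulVec, ← hT j, ← Matrix.mulVec_mulVec, hv, Matrix.mulVec_smul]
  apply Matrix.toLin'.injective
  ext1 i
  ext1
  have hv : (Pi.single i 1 : n → ℂ) ∈ Module.End.eigenspace (Matrix.toLin' T) c := by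
    rw [htop]; trivial
  rw [Module.End.mem_eigenspace_iff] at hv
  simp [hv]

theorem orderedMonomial_mul_conjTranspose (hΓ : IsIrreducibleCliffordRep Γ) (s : Fin d → Bool) :
    (orderedMonomial Γ s)ᴴ * orderedMonomial Γ s = 1 := by
  have hmem : orderedMonomial Γ s ∈ unitary (Matrix n n ℂ) := by
    apply Submonoid.list_prod_mem
    intro x hx
    rw [List.mem_ofFn] at hx
    obtain ⟨i, rfl⟩ := hx
    split_ifs
    · have h := hΓ.isHermitian i
      rw [Unitary.mem_iff, Matrix.star_eq_conjTranspose, h.eq]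
      exact ⟨hΓ.sq_eq_one i, hΓ.sq_eq_one i⟩
    · exact one_mem _
  exact (Unitary.mem_iff.mp hmem).1

/-- Some generator anticommutes with the monomial: one of its own factors if the number of factors
is even, one not occurring in it if that number is odd. The latter exists because `d` is even. -/
theorem trace_orderedMonomial (hΓ : IsIrreducibleCliffordRep Γ) (hd : Even d) (s : Fin d → Bool)
    (hs : s ≠ fun _ => false) : (orderedMonomial Γ s).trace = 0 := by
  have key : ∀ j, ∏ i, (if i = j then (1 : ℤ) else if s i then -1 else 1) = -1 →
      (orderedMonomial Γ s).trace = 0 := by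
    intro j hj
    apply Matrix.trace_eq_zero_of_anticomm (hΓ.sq_eq_one j)
    unfold orderedMonomial
    rw [mul_prod_ofFn_of_sign_comm (Γ j) _
      (fun i => if i = j then (1 : ℤ) else if s i then -1 else 1), hj, neg_one_smul]
    intro i
    by_cases hij : i = j
    · subst hij; cases s i <;> simp
    · cases hsi : s i
      · simp
      · simpa [hij] using hΓ.anticomm j i (Ne.symm hij)
  have hprod : ∀ j, (∏ i, (if i = j then (1 : ℤ) else if s i then -1 else 1)) *
      (if s j then -1 else 1) = ∏ i, (if s i then (-1 : ℤ) else 1) := by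
    intro j
    have : (if s j then (-1 : ℤ) else 1) = ∏ i, (if i = j then (if s i then (-1 : ℤ) else 1) else 1)
        := by
      rw [Finset.prod_ite_eq' Finset.univ j (fun i => if s i then (-1 : ℤ) else 1)]; simp
    rw [this, ← Finset.prod_mul_distrib]
    apply Finset.prod_congr rfl
    intro i _
    split_ifs <;> rfl
  have hσ : (∏ i, (if s i then (-1 : ℤ) else 1)) = 1 ∨ (∏ i, (if s i then (-1 : ℤ) else 1)) = -1 := by
    refine Finset.prod_induction _ (fun x : ℤ => x = 1 ∨ x = -1) ?_ (Or.inl rfl) ?_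
    · rintro a b (rfl | rfl) (rfl | rfl) <;> simp
    · intro i _; split_ifs <;> simp
  rcases hσ with h1 | h1
  · obtain ⟨j, hj⟩ := Function.ne_iff.mp hs
    have hp := hprod j
    have hj' : s j = true := by simpa using hj
    rw [h1, hj'] at hp
    exact key j (by simp only [if_true] at hp; omega)
  · by_cases hall : ∀ j, s j = true
    · simp [hall, hd.neg_one_pow] at h1
    · push Not at hall
      obtain ⟨j, hj⟩ := hall
      have hp := hprod j
      rw [h1] at hp
      exact key j (by simpa [hj] using hp)

/-- Character orthogonality: averaging over all monomials yields a scalar by Schur, whence `∑ |Tr (G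
s)| ^ 2 = 2 ^ d`, while only the empty monomial has a non-zero trace. -/
theorem card_sq (hΓ : IsIrreducibleCliffordRep Γ) (hd : Even d) :
    (Fintype.card n : ℂ) ^ 2 = 2 ^ d := by
  have := hΓ.nonempty
  set G := orderedMonomial Γ with hG
  have hT : ∀ A : Matrix n n ℂ, (Fintype.card n : ℂ) • ∑ s, G s * A * (G s)ᴴ =
      ((2 : ℂ) ^ d * A.trace) • 1 := by
    intro A
    obtain ⟨c, hc⟩ := hΓ.eq_smul_one_of_commute (∑ s, G s * A * (G s)ᴴ) (by
      intro j
      have hinv : Γ j * (∑ s, G s * A * (G s)ᴴ) * Γ j = ∑ s, G s * A * (G s)ᴴ := by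
        have hinvol : Function.Involutive
            (fun s : Fin d → Bool => Function.update s j (!s j)) := by
          intro s; simp
        rw [Finset.mul_sum, Finset.sum_mul]
        apply Fintype.sum_equiv hinvol.toPerm
        intro s
        have e : Γ j * (G s * A * (G s)ᴴ) * Γ j = (Γ j * G s) * A * (Γ j * G s)ᴴ := by
          rw [Matrix.conjTranspose_mul, (hΓ.isHermitian j).eq]
          simp only [mul_assoc]
        rw [e]
        rcases mul_orderedMonomial Γ hΓ.sq_eq_one hΓ.anticomm j s with h | h <;>
          rw [← hG] at h <;> simp [h]
      calc Γ j * (∑ s, G s * A * (G s)ᴴ)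
          = Γ j * (∑ s, G s * A * (G s)ᴴ) * (Γ j * Γ j) := by rw [hΓ.sq_eq_one, mul_one]
        _ = _ := by rw [← mul_assoc, hinv])
    have htr : (∑ s, G s * A * (G s)ᴴ).trace = 2 ^ d * A.trace := by
      rw [Matrix.trace_sum]
      have : ∀ s, (G s * A * (G s)ᴴ).trace = A.trace := by
        intro s
        rw [Matrix.trace_mul_comm, ← mul_assoc, hG, hΓ.orderedMonomial_mul_conjTranspose, one_mul]
      simp [this]
    rw [hc, Matrix.trace_smul, Matrix.trace_one] at htr
    rw [hc, smul_smul, ← htr, smul_eq_mul, mul_comm]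
  -- Matrix units as `A` extract products of diagonal entries, which sum over `a`, `b` to products
  -- of traces.
  have hcoef : ∀ a b : n, (Fintype.card n : ℂ) * ∑ s, G s a a * star (G s b b) =
      if a = b then 2 ^ d else 0 := by
    intro a b
    have h := congrFun (congrFun (hT (Matrix.single a b 1)) a) b
    simp only [Matrix.smul_apply, Matrix.sum_apply, smul_eq_mul, Matrix.one_apply] at h
    have e : ∀ s, (G s * Matrix.single a b 1 * (G s)ᴴ : Matrix n n ℂ) a b = G s a a * star (G s b b) := by
      intro s
      rw [Matrix.mul_apply, Finset.sum_eq_single b]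
      · simp
      · intro c _ hc
        simp [Matrix.mul_single_apply_of_ne, hc]
      · simp
    simp only [e] at h
    rw [h]
    split_ifs with hab
    · subst hab; simp
    · simp
  have hsum : ∑ a : n, ∑ b : n, (∑ s, G s a a * star (G s b b)) = (Fintype.card n : ℂ) ^ 2 := by
    have : ∑ a : n, ∑ b : n, (∑ s, G s a a * star (G s b b)) =
        ∑ s, (G s).trace * star (G s).trace := by
      simp_rw [Matrix.trace, star_sum, Finset.sum_mul_sum, Matrix.diag_apply]
      rw [Finset.sum_comm (s := (Finset.univ : Finset (Fin d → Bool)))]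
      exact Finset.sum_congr rfl fun a _ => Finset.sum_comm
    rw [this, Finset.sum_eq_single (fun _ => false)]
    · simp [hG, orderedMonomial, sq]
    · intro s _ hs
      rw [hG, hΓ.trace_orderedMonomial hd s hs, zero_mul]
    · simp
  have h2 : (Fintype.card n : ℂ) * (Fintype.card n : ℂ) ^ 2 = Fintype.card n * 2 ^ d := by
    rw [← hsum, Finset.mul_sum]
    simp_rw [Finset.mul_sum (s := (Finset.univ : Finset n)), hcoef]
    simp
  exact mul_left_cancel₀ (by exact_mod_cast Fintype.card_ne_zero) h2

theorem card_eq (hΓ : IsIrreducibleCliffordRep Γ) (hd : Even d) :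
    Fintype.card n = 2 ^ (d / 2) := by
  have h := hΓ.card_sq hd
  have h2 : Fintype.card n ^ 2 = (2 ^ (d / 2)) ^ 2 := by
    rw [← pow_mul, Nat.div_mul_cancel hd.two_dvd]
    exact_mod_cast h
  exact Nat.pow_left_injective two_ne_zero h2

end IsIrreducibleCliffordRep

/-! ### The antisymmetrised trace -/

/-- The alternating map `(X_1, …, X_d) ↦ ∑_ρ (-1)^ρ Tr (A X_ρ(1) ⋯ X_ρ(d))`. -/
noncomputable def alternatingTrace {n : Type*} [Fintype n] [DecidableEq n] (d : ℕ)
    (A : Matrix n n ℂ) : (Matrix n n ℂ) [⋀^Fin d]→ₗ[ℂ] ℂ :=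
  MultilinearMap.alternatization
    (((Matrix.traceLinearMap n ℂ ℂ).comp (LinearMap.mulLeft ℂ A)).compMultilinearMap
      (MultilinearMap.mkPiAlgebraFin ℂ d (Matrix n n ℂ)))

theorem alternatingTrace_apply {n : Type*} [Fintype n] [DecidableEq n] {d : ℕ}
    (A : Matrix n n ℂ) (X : Fin d → Matrix n n ℂ) :
    alternatingTrace d A X = ∑ ρ : Equiv.Perm (Fin d), ((Equiv.Perm.sign ρ : ℤ) : ℂ) *
      (A * (List.ofFn fun j => X (ρ j)).prod).trace := by
  simp [alternatingTrace, MultilinearMap.alternatization_apply, Units.smul_def]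

theorem AlternatingMap.map_eq_zero_of_smul_of_smul {R M N ι : Type*} [CommRing R]
    [AddCommGroup M] [Module R M] [AddCommGroup N] [Module R N] [DecidableEq ι]
    (f : M [⋀^ι]→ₗ[R] N) (v : ι → M) {i j : ι} (hij : i ≠ j) {a b : R} {x : M}
    (hi : v i = a • x) (hj : v j = b • x) : f v = 0 := by
  have h1 : v = Function.update (Function.update v i (a • x)) j (b • x) := by
    rw [← hi, Function.update_eq_self, ← hj, Function.update_eq_self]
  rw [h1, f.map_update_smul, Function.update_comm hij, f.map_update_smul,
    f.map_eq_zero_of_eq _ (i := i) (j := j) _ hij, smul_zero, smul_zero]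
  simp [Function.update_of_ne hij.symm]

/-- Expand multilinearly. Two slots proportional to `A` give zero by alternation. With exactly one
such slot, `A` commutes with it and anticommutes with the other `d - 1`, an odd number, so `A`
anticommutes with the whole product and the trace vanishes. -/
theorem alternatingTrace_add_smul {n : Type*} [Fintype n] [DecidableEq n] {d : ℕ} (hd : Even d)
    (A : Matrix n n ℂ) (X : Fin d → Matrix n n ℂ) (hX : ∀ i, A * X i = -(X i * A))
    (c : Fin d → ℂ) :
    alternatingTrace d A (fun i => X i + c i • A) = alternatingTrace d A X := by
  have hadd : (fun i => X i + c i • A) = X + fun i => c i • A := rfl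
  rw [hadd, AlternatingMap.map_add_univ, Finset.sum_eq_single Finset.univ]
  · simp
  · intro s _ hs
    obtain ⟨i, hi⟩ : ∃ i, i ∉ s := by
      by_contra h
      push Not at h
      exact hs (Finset.eq_univ_of_forall h)
    by_cases h2 : ∃ j, j ∉ s ∧ i ≠ j
    · obtain ⟨j, hj, hij⟩ := h2
      exact AlternatingMap.map_eq_zero_of_smul_of_smul _ _ hij (a := c i) (b := c j) (x := A)
        (by simp [hi]) (by simp [hj])
    · push Not at h2
      rw [alternatingTrace_apply]
      apply Finset.sum_eq_zero
      intro ρ _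
      rw [Matrix.trace_mul_eq_zero_of_anticomm, mul_zero]
      refine mul_prod_ofFn_of_anticomm hd A _ (ρ.symm i) (by simp [hi]) ?_
      intro j hj
      have : ρ j ∈ s := by
        by_contra h
        exact hj (by simp [h2 _ h])
      simp [this, hX]
  · simp

theorem alternatingTrace_one {n : Type*} [Fintype n] [DecidableEq n] {d : ℕ} (hd : Even d)
    (hd0 : 0 < d) (X : Fin d → Matrix n n ℂ) : alternatingTrace d 1 X = 0 := by
  obtain ⟨e, rfl⟩ : ∃ e, d = e + 1 := ⟨d - 1, by omega⟩
  have hodd : Odd e := by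
    rcases Nat.even_or_odd e with h | h
    · exact absurd hd (by simpa [Nat.even_add_one] using h)
    · exact h
  have h : alternatingTrace (e + 1) 1 X = -alternatingTrace (e + 1) 1 X := by
    conv_lhs => rw [alternatingTrace_apply]
    rw [alternatingTrace_apply, ← Finset.sum_neg_distrib]
    -- The cyclic shift preserves the trace, but as a cycle of even length `e + 1` it is an odd
    -- permutation.
    refine Fintype.sum_equiv (Equiv.mulRight (finRotate (e + 1))) _ _ fun ρ => ?_
    have h1 : (List.ofFn fun j => X ((ρ * finRotate (e + 1)) j)).prod =
        (List.ofFn fun j : Fin e => X (ρ j.succ)).prod * X (ρ 0) := by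
      rw [List.ofFn_succ', List.concat_eq_append, List.prod_append, List.prod_singleton]
      simp
    simp only [Equiv.coe_mulRight, one_mul]
    rw [h1, Matrix.trace_mul_comm, List.ofFn_succ, List.prod_cons, Equiv.Perm.sign_mul,
      sign_finRotate]
    simp [hodd.neg_one_pow]
  exact self_eq_neg.mp h

theorem alternatingTrace_eq_factorial {n : Type*} [Fintype n] [DecidableEq n] {d : ℕ}
    (A : Matrix n n ℂ) (X : Fin d → Matrix n n ℂ) (h : ∀ i j, i ≠ j → X i * X j = -(X j * X i)) :
    alternatingTrace d A X = d.factorial * (A * (List.ofFn X).prod).trace := by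
  rw [alternatingTrace_apply]
  have : ∀ ρ : Equiv.Perm (Fin d), ((Equiv.Perm.sign ρ : ℤ) : ℂ) *
      (A * (List.ofFn fun j => X (ρ j)).prod).trace = (A * (List.ofFn X).prod).trace := by
    intro ρ
    have := prod_ofFn_comp_perm X h ρ
    rw [show (List.ofFn fun j => X (ρ j)) = List.ofFn (X ∘ ρ) from rfl, this]
    rcases Int.units_eq_one_or (Equiv.Perm.sign ρ) with h | h <;> simp [h]
  rw [Finset.sum_congr rfl fun ρ _ => this ρ]
  simp [Fintype.card_perm]

/-! ### Algebra of the chirality matrix and the Hamiltonian -/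

theorem prod_ofFn_mul_self {A : Type*} [Ring A] {d : ℕ} (X : Fin d → A)
    (hsq : ∀ i, X i * X i = 1) (h : ∀ i j, i ≠ j → X i * X j = -(X j * X i)) :
    (List.ofFn X).prod * (List.ofFn X).prod = (-1) ^ (d * (d - 1) / 2) := by
  induction d with
  | zero => simp
  | succ d ih =>
    have h1 := ih (fun i => X i.succ) (fun i => hsq _)
      (fun i j hij => h _ _ (fun e => hij (Fin.succ_injective _ e)))
    have h2 := mul_prod_ofFn_of_sign_comm (X 0) (fun i => X i.succ) (fun _ => -1) (by
      intro i; simpa using h _ _ (Fin.succ_ne_zero i).symm)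
    have h3 : (d + 1) * (d + 1 - 1) / 2 = d + d * (d - 1) / 2 := by
      rw [← Finset.sum_range_id_mul_two, ← Finset.sum_range_id_mul_two]
      simp [Finset.sum_range_succ, add_comm]
    simp only [Finset.prod_const, Finset.card_univ, Fintype.card_fin] at h2
    set R := (List.ofFn fun i => X i.succ).prod
    have h4 : R * X 0 = (-1 : ℤ) ^ d • (X 0 * R) := by
      rw [h2, smul_smul, ← mul_pow]; simp
    rw [List.ofFn_succ, List.prod_cons, h3, pow_add, ← h1]
    calc X 0 * R * (X 0 * R) = X 0 * (R * X 0) * R := by noncomm_ring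
      _ = (-1 : ℤ) ^ d • (X 0 * X 0 * (R * R)) := by
        rw [h4, mul_smul_comm, smul_mul_assoc]; simp only [mul_assoc]
      _ = _ := by rw [hsq, one_mul, zsmul_eq_mul]; simp

namespace IsIrreducibleCliffordRep

variable {d : ℕ} {n : Type*} [Fintype n] [DecidableEq n] {Γ : Fin d → Matrix n n ℂ}

theorem mul_prod (hΓ : IsIrreducibleCliffordRep Γ) (hd : Even d) (j : Fin d) :
    Γ j * (List.ofFn Γ).prod = -((List.ofFn Γ).prod * Γ j) :=
  mul_prod_ofFn_of_anticomm hd _ _ j rfl fun i hi => hΓ.anticomm j i hi.symm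

theorem mul_chiralityMatrix (hΓ : IsIrreducibleCliffordRep Γ) (hd : Even d) (j : Fin d) :
    Γ j * chiralityMatrix Γ = -(chiralityMatrix Γ * Γ j) := by
  simp [chiralityMatrix, hΓ.mul_prod hd]

theorem chiralityMatrix_sq (hΓ : IsIrreducibleCliffordRep Γ) (hd : Even d) :
    chiralityMatrix Γ * chiralityMatrix Γ = 1 := by
  unfold chiralityMatrix
  rw [smul_mul_smul_comm, prod_ofFn_mul_self Γ hΓ.sq_eq_one hΓ.anticomm]
  obtain ⟨p, rfl⟩ := hd
  have e1 : (p + p) / 2 = p := by omega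
  have e2 : (p + p) * (p + p - 1) / 2 = p * (p + p - 1) := by
    rw [← two_mul, mul_assoc, Nat.mul_div_cancel_left _ two_pos]
  rw [e1, e2, ← mul_pow, pow_mul]
  rcases Nat.eq_zero_or_pos p with rfl | hp
  · simp
  · have hodd : Odd (p + p - 1) := ⟨p - 1, by omega⟩
    rcases Nat.even_or_odd p with h | h
    · simp [h.neg_one_pow]
    · simp [h.neg_one_pow, hodd.neg_one_pow]

theorem isHermitian_chiralityMatrix (hΓ : IsIrreducibleCliffordRep Γ) (hd : Even d) :
    (chiralityMatrix Γ).IsHermitian := by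
  have hU : chiralityMatrix Γ ∈ unitary (Matrix n n ℂ) := by
    have h1 : (List.ofFn Γ).prod ∈ unitary (Matrix n n ℂ) := by
      apply Submonoid.list_prod_mem
      intro x hx
      rw [List.mem_ofFn] at hx
      obtain ⟨i, rfl⟩ := hx
      rw [Unitary.mem_iff, Matrix.star_eq_conjTranspose, (hΓ.isHermitian i).eq]
      exact ⟨hΓ.sq_eq_one i, hΓ.sq_eq_one i⟩
    rw [Unitary.mem_iff] at h1 ⊢
    have hI : (starRingEnd ℂ) ((-Complex.I) ^ (d / 2)) * (-Complex.I) ^ (d / 2) = 1 := by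
      rw [map_pow, ← mul_pow]; simp
    constructor
    · rw [chiralityMatrix, star_smul, smul_mul_smul_comm, h1.1]
      simp only [RCLike.star_def]
      rw [hI, one_smul]
    · rw [chiralityMatrix, star_smul, smul_mul_smul_comm, h1.2]
      simp only [RCLike.star_def]
      rw [mul_comm, hI, one_smul]
  have h := (Unitary.mem_iff.mp hU).1
  rw [Matrix.IsHermitian]
  calc (chiralityMatrix Γ)ᴴ = (chiralityMatrix Γ)ᴴ * (chiralityMatrix Γ * chiralityMatrix Γ) := by
        rw [hΓ.chiralityMatrix_sq hd, mul_one]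
    _ = _ := by rw [← mul_assoc, ← Matrix.star_eq_conjTranspose, h, one_mul]

theorem isHermitian_massiveDiracHamiltonian (hΓ : IsIrreducibleCliffordRep Γ) (hd : Even d)
    (b : Fin d → ℝ) (m : ℝ) (k : Fin d → ℝ) : (massiveDiracHamiltonian Γ b m k).IsHermitian := by
  have hreal : ∀ (x : ℝ) (M : Matrix n n ℂ), M.IsHermitian → ((x : ℂ) • M).IsHermitian := by
    intro x M hM
    rw [Matrix.IsHermitian, Matrix.conjTranspose_smul, hM.eq]; simp
  unfold massiveDiracHamiltonian diracHamiltonian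
  refine Matrix.IsHermitian.add ?_ (hreal _ _ (hΓ.isHermitian_chiralityMatrix hd))
  rw [Matrix.IsHermitian, Matrix.conjTranspose_sum]
  exact Finset.sum_congr rfl fun j _ => (hreal _ _ (hΓ.isHermitian j)).eq

theorem mul_massiveDiracHamiltonian_add (hΓ : IsIrreducibleCliffordRep Γ) (hd : Even d)
    (b : Fin d → ℝ) (m : ℝ) (k : Fin d → ℝ) (j : Fin d) :
    massiveDiracHamiltonian Γ b m k * Γ j + Γ j * massiveDiracHamiltonian Γ b m k =
      (2 * (b j * k j : ℝ) : ℂ) • 1 := by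
  unfold massiveDiracHamiltonian diracHamiltonian
  have h0 := hΓ.mul_chiralityMatrix hd j
  rw [add_mul, mul_add, Finset.sum_mul, Finset.mul_sum, smul_mul_assoc, mul_smul_comm, h0, smul_neg]
  have : ∀ x y z : Matrix n n ℂ, x + y + (z + -y) = x + z := by intros; abel
  rw [this, ← Finset.sum_add_distrib, Finset.sum_eq_single j]
  · rw [smul_mul_assoc, mul_smul_comm, hΓ.sq_eq_one, ← add_smul, two_mul]
  · intro i _ hi
    rw [smul_mul_assoc, mul_smul_comm, hΓ.anticomm i j hi]; simp
  · simp

theorem massiveDiracHamiltonian_sq (hΓ : IsIrreducibleCliffordRep Γ) (hd : Even d)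
    (b : Fin d → ℝ) (m : ℝ) (k : Fin d → ℝ) :
    massiveDiracHamiltonian Γ b m k * massiveDiracHamiltonian Γ b m k =
      ((∑ j, (b j * k j) ^ 2 + m ^ 2 : ℝ) : ℂ) • 1 := by
  set H := massiveDiracHamiltonian Γ b m k with hH
  have h0 : H * chiralityMatrix Γ + chiralityMatrix Γ * H = (2 * m : ℂ) • 1 := by
    rw [hH]
    unfold massiveDiracHamiltonian diracHamiltonian
    rw [add_mul, mul_add, Finset.sum_mul, Finset.mul_sum, smul_mul_assoc, mul_smul_comm,
      hΓ.chiralityMatrix_sq hd]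
    have : ∀ x y z : Matrix n n ℂ, x + y + (z + y) = (x + z) + (y + y) := by intros; abel
    rw [this, ← Finset.sum_add_distrib, Finset.sum_eq_zero, zero_add, ← add_smul, two_mul]
    intro i _
    rw [smul_mul_assoc, mul_smul_comm, hΓ.mul_chiralityMatrix hd]; simp
  have hexp : H = ∑ j, ((b j * k j : ℝ) : ℂ) • Γ j + (m : ℂ) • chiralityMatrix Γ := rfl
  -- Doubling the square, with one factor expanded, leaves only anticommutators of `H` with the `Γ
  -- j` and the chirality matrix, all of them scalar.
  have h2 : H * H + H * H = (2 * ((∑ j, (b j * k j) ^ 2 + m ^ 2 : ℝ) : ℂ)) • 1 := by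
    have e : H * H + H * H = ∑ j, ((b j * k j : ℝ) : ℂ) • (H * Γ j + Γ j * H) +
        (m : ℂ) • (H * chiralityMatrix Γ + chiralityMatrix Γ * H) := by
      conv_lhs =>
        congr
        · rw [hexp, ← hexp]
          arg 2
          rw [hexp]
        · arg 1
          rw [hexp]
      rw [add_mul, mul_add, Finset.sum_mul, Finset.mul_sum]
      simp only [smul_add, Finset.sum_add_distrib, smul_mul_assoc, mul_smul_comm]
      abel
    rw [e, h0]
    simp only [hH, hΓ.mul_massiveDiracHamiltonian_add hd, smul_smul]
    rw [← Finset.sum_smul, ← add_smul]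
    congr 1
    push_cast
    rw [mul_add, Finset.mul_sum]
    congr 1
    · exact Finset.sum_congr rfl fun j _ => by ring
    · ring
  rw [← two_smul ℂ, mul_smul] at h2
  exact smul_right_injective _ (two_ne_zero (α := ℂ)) h2

theorem trace_massiveDiracHamiltonian_mul_prod (hΓ : IsIrreducibleCliffordRep Γ) (hd : Even d)
    (b : Fin d → ℝ) (m : ℝ) (k : Fin d → ℝ) :
    (massiveDiracHamiltonian Γ b m k * (List.ofFn Γ).prod).trace =
      Complex.I ^ (d / 2) * m * 2 ^ (d / 2) := by
  have hprod : (List.ofFn Γ).prod = Complex.I ^ (d / 2) • chiralityMatrix Γ := by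
    rw [chiralityMatrix, smul_smul, ← mul_pow]; simp
  have hz : ∀ j, (Γ j * (List.ofFn Γ).prod).trace = 0 := fun j =>
    Matrix.trace_mul_eq_zero_of_anticomm (hΓ.mul_prod hd j)
  have hone : (chiralityMatrix Γ * (List.ofFn Γ).prod) = Complex.I ^ (d / 2) • 1 := by
    rw [hprod, mul_smul_comm, hΓ.chiralityMatrix_sq hd]
  unfold massiveDiracHamiltonian diracHamiltonian
  rw [add_mul, Matrix.trace_add, Finset.sum_mul, Matrix.trace_sum, Finset.sum_eq_zero, zero_add,
    smul_mul_assoc, hone, Matrix.trace_smul, Matrix.trace_smul, Matrix.trace_one, hΓ.card_eq hd]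
  · simp; ring
  · intro j _
    rw [smul_mul_assoc, Matrix.trace_smul, hz, smul_zero]

end IsIrreducibleCliffordRep

/-! ### The momentum integral -/

open MeasureTheory in
theorem integral_exp_neg_mul_sum_sq {d : ℕ} (b : Fin d → ℝ) (hb : ∀ j, b j ≠ 0) {t : ℝ}
    (ht : 0 < t) :
    Integrable (fun k : Fin d → ℝ => Real.exp (-(t * ∑ j, (b j * k j) ^ 2))) ∧
    ∫ k : Fin d → ℝ, Real.exp (-(t * ∑ j, (b j * k j) ^ 2)) =
      Real.sqrt (Real.pi / t) ^ d * |∏ j, b j|⁻¹ := by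
  have hexp : (fun k : Fin d → ℝ => Real.exp (-(t * ∑ j, (b j * k j) ^ 2))) =
      fun k => ∏ j, Real.exp (-(t * b j ^ 2) * k j ^ 2) := by
    funext k
    rw [← Real.exp_sum, Finset.mul_sum, ← Finset.sum_neg_distrib]
    exact congrArg _ (Finset.sum_congr rfl fun j _ => by ring)
  have hpos : ∀ j, 0 < t * b j ^ 2 := fun j => mul_pos ht (by have := hb j; positivity)
  rw [hexp]
  constructor
  · exact Integrable.fintype_prod (f := fun j (x : ℝ) => Real.exp (-(t * b j ^ 2) * x ^ 2))
      fun j => integrable_exp_neg_mul_sq (hpos j)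
  · rw [integral_fintype_prod_volume_eq_prod
      (fun j (x : ℝ) => Real.exp (-(t * b j ^ 2) * x ^ 2))]
    simp only [integral_gaussian]
    rw [Finset.abs_prod, ← Finset.prod_inv_distrib]
    have : ∀ j, Real.sqrt (Real.pi / (t * b j ^ 2)) = Real.sqrt (Real.pi / t) * |b j|⁻¹ := by
      intro j
      rw [← div_div, Real.sqrt_div' _ (sq_nonneg _), Real.sqrt_sq_eq_abs, div_eq_mul_inv]
    simp [this, Finset.prod_mul_distrib]

-- With `a = p + 1/2`, `Γ(a) / E ^ (2a)` is the integral of `t ^ (a - 1) exp (-E ^ 2 t)` over `t >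
-- 0`. Integrating over `k` first gives a factor `(π / t) ^ p`, which leaves `t ^ (-1/2) exp (-m ^ 2
-- t)`, a Gamma integral at `1/2`.
open MeasureTheory in
theorem integral_rpow_neg_add_half {p : ℕ} (b : Fin (p + p) → ℝ) (hb : ∀ j, b j ≠ 0) {m : ℝ}
    (hm : m ≠ 0) :
    Integrable (fun k : Fin (p + p) → ℝ =>
      (1 / (∑ j, (b j * k j) ^ 2 + m ^ 2)) ^ ((p : ℝ) + 1 / 2)) ∧
    ∫ k : Fin (p + p) → ℝ, (1 / (∑ j, (b j * k j) ^ 2 + m ^ 2)) ^ ((p : ℝ) + 1 / 2) =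
      Real.pi ^ p * Real.sqrt Real.pi / (Real.Gamma (p + 1 / 2) * |m| * |∏ j, b j|) := by
  set a : ℝ := (p : ℝ) + 1 / 2 with ha
  have ha0 : 0 < a := by positivity
  have hΓ : 0 < Real.Gamma a := Real.Gamma_pos_of_pos ha0
  have hm2 : 0 < m ^ 2 := by positivity
  set F : (Fin (p + p) → ℝ) → ℝ → ℝ := fun k t =>
    t ^ (a - 1) * Real.exp (-((∑ j, (b j * k j) ^ 2 + m ^ 2) * t)) with hF
  have hFt : ∀ t : ℝ, (fun k => F k t) = fun k => t ^ (a - 1) * Real.exp (-(m ^ 2 * t)) *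
      Real.exp (-(t * ∑ j, (b j * k j) ^ 2)) := by
    intro t
    funext k
    rw [hF, mul_assoc, ← Real.exp_add]
    exact congrArg (fun x => t ^ (a - 1) * Real.exp x) (by ring)
  have hint_k : ∀ k, ∫ t in Set.Ioi 0, F k t =
      (1 / (∑ j, (b j * k j) ^ 2 + m ^ 2)) ^ a * Real.Gamma a := by
    intro k
    exact Real.integral_rpow_mul_exp_neg_mul_Ioi ha0
      (add_pos_of_nonneg_of_pos (Finset.sum_nonneg fun j _ => sq_nonneg _) hm2)
  have hint_t : ∀ t ∈ Set.Ioi (0 : ℝ), ∫ k, F k t =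
      Real.pi ^ p * |∏ j, b j|⁻¹ * (t ^ ((1 / 2 : ℝ) - 1) * Real.exp (-(m ^ 2 * t))) := by
    intro t ht
    have ht' : 0 < t := ht
    rw [hFt t, integral_const_mul, (integral_exp_neg_mul_sum_sq b hb ht').2, pow_add, ← mul_pow,
      Real.mul_self_sqrt (by positivity), div_pow]
    have : t ^ (a - 1) = t ^ p * t ^ ((1 / 2 : ℝ) - 1) := by
      rw [← Real.rpow_natCast, ← Real.rpow_add ht', ha]
      congr 1; ring
    rw [this]
    field_simp
  have hF0 : ∀ k, ∀ t ∈ Set.Ioi (0 : ℝ), 0 ≤ F k t := by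
    intro k t ht
    exact mul_nonneg (Real.rpow_nonneg (le_of_lt ht) _) (Real.exp_nonneg _)
  have hmeas : Measurable (Function.uncurry F) := by
    simp only [hF, Function.uncurry_def]
    fun_prop
  -- Joint integrability, checked by iterating in the convenient order since `F` is non-negative,
  -- justifies the exchange and also gives integrability in `k`.
  have hprod : Integrable (Function.uncurry F)
      ((volume : Measure (Fin (p + p) → ℝ)).prod (volume.restrict (Set.Ioi (0 : ℝ)))) := by
    rw [integrable_prod_iff' hmeas.aestronglyMeasurable]
    constructor
    · refine (ae_restrict_iff' measurableSet_Ioi).mpr (ae_of_all _ fun t ht => ?_)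
      have := hFt t
      simp only [Function.uncurry_apply_pair]
      rw [this]
      exact (integral_exp_neg_mul_sum_sq b hb ht).1.const_mul _
    · have hI : IntegrableOn (fun t : ℝ => Real.pi ^ p * |∏ j, b j|⁻¹ *
          (t ^ ((1 / 2 : ℝ) - 1) * Real.exp (-(m ^ 2 * t)))) (Set.Ioi 0) := by
        refine Integrable.const_mul ?_ _
        have := integrableOn_rpow_mul_exp_neg_mul_rpow (p := 1) (s := (1 / 2 : ℝ) - 1)
          (b := m ^ 2) (by norm_num) one_pos hm2
        simpa only [Real.rpow_one, neg_mul] using! this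
      refine hI.congr_fun (fun t ht => ?_) measurableSet_Ioi
      simp only [Function.uncurry_apply_pair]
      rw [← hint_t t ht]
      exact integral_congr_ae (ae_of_all _ fun k => (Real.norm_of_nonneg (hF0 k t ht)).symm)
  have hscale : ∀ k : Fin (p + p) → ℝ, (1 / (∑ j, (b j * k j) ^ 2 + m ^ 2)) ^ a =
      (Real.Gamma a)⁻¹ * ∫ t in Set.Ioi 0, F k t := by
    intro k
    rw [hint_k]
    field_simp
  simp only [hscale]
  constructor
  · exact hprod.integral_prod_left.const_mul _
  · rw [integral_const_mul, integral_integral_swap hprod, setIntegral_congr_fun measurableSet_Ioi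
      hint_t, integral_const_mul, Real.integral_rpow_mul_exp_neg_mul_Ioi (by norm_num) hm2,
      Real.Gamma_one_half_eq, ← Real.sqrt_eq_rpow, Real.sqrt_div' _ hm2.le, Real.sqrt_one,
      Real.sqrt_sq_eq_abs]
    field_simp

/-- Legendre duplication at half-integers; it cancels `d!` from the antisymmetrisation against the
Gamma factor of the integral. -/
theorem factorial_two_mul_eq (p : ℕ) :
    ((p + p).factorial : ℝ) * Real.sqrt Real.pi = 4 ^ p * p.factorial * Real.Gamma (p + 1 / 2) := by
  induction p with
  | zero => simpa using Real.Gamma_one_half_eq.symm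
  | succ p ih =>
    have e : p + 1 + (p + 1) = (p + p) + 1 + 1 := by ring
    have hG : Real.Gamma (((p + 1 : ℕ) : ℝ) + 1 / 2) =
        ((p : ℝ) + 1 / 2) * Real.Gamma (p + 1 / 2) := by
      rw [← Real.Gamma_add_one (by positivity)]
      congr 1; push_cast; ring
    rw [hG, e, Nat.factorial_succ, Nat.factorial_succ, Nat.factorial_succ]
    push_cast
    linear_combination (((p : ℝ) + p + 1 + 1) * (p + p + 1)) * ih

/-! ### The projection, its derivatives and the Chern density -/

/-- The spectrum lies in `{E, -E}`, where the indicator agrees with the affine function `1/2 - x /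
(2E)`. -/
theorem negativeSpectralProjection_eq {n : Type*} [Fintype n] [DecidableEq n] {A : Matrix n n ℂ}
    (hA : A.IsHermitian) {E : ℝ} (hE : 0 < E) (hsq : A * A = ((E ^ 2 : ℝ) : ℂ) • 1) :
    negativeSpectralProjection A = (1 / 2 : ℂ) • (1 - ((E⁻¹ : ℝ) : ℂ) • A) := by
  have hsa : IsSelfAdjoint A := hA
  have hspec : ∀ x ∈ spectrum ℝ A, x = E ∨ x = -E := by
    intro x hx
    rw [← sq_eq_sq_iff_eq_or_eq_neg]
    have h2 := spectrum.pow_mem_pow A 2 hx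
    by_contra hne
    apply h2
    have : algebraMap ℝ (Matrix n n ℂ) (x ^ 2) - A ^ 2 =
        algebraMap ℝ (Matrix n n ℂ) (x ^ 2 - E ^ 2) := by
      rw [map_sub, sq A, hsq, Algebra.algebraMap_eq_smul_one (E ^ 2)]
      congr 1
    rw [spectrum.mem_resolventSet_iff, this]
    exact (IsUnit.mk0 _ (sub_ne_zero.mpr hne)).map _
  have hcongr : (spectrum ℝ A).EqOn (Set.indicator (Set.Iio (0 : ℝ)) (fun _ => (1 : ℝ)))
      (fun x => 1 / 2 - (1 / 2 * E⁻¹) * x) := by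
    intro x hx
    rcases hspec x hx with rfl | rfl
    · simp [hE.le, hE.ne']
    · simp [hE, hE.ne']; norm_num
  rw [negativeSpectralProjection, cfc_congr hcongr, cfc_sub (fun _ => 1 / 2) _ A,
    cfc_const_mul_id _ A, cfc_const _ A, Algebra.algebraMap_eq_smul_one, smul_sub, smul_smul]
  congr 1
  · ext i j; simp [Matrix.smul_apply]
  · ext i j; simp [Matrix.smul_apply]

namespace IsIrreducibleCliffordRep

variable {d : ℕ} {n : Type*} [Fintype n] [DecidableEq n] {Γ : Fin d → Matrix n n ℂ}

theorem diracProjection_eq (hΓ : IsIrreducibleCliffordRep Γ) (hd : Even d) (b : Fin d → ℝ) {m : ℝ}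
    (hm : m ≠ 0) (k : Fin d → ℝ) :
    diracProjection Γ b m k = (1 / 2 : ℂ) •
      (1 - (((Real.sqrt (∑ j, (b j * k j) ^ 2 + m ^ 2))⁻¹ : ℝ) : ℂ) •
        massiveDiracHamiltonian Γ b m k) := by
  have hpos : 0 < ∑ j, (b j * k j) ^ 2 + m ^ 2 :=
    add_pos_of_nonneg_of_pos (Finset.sum_nonneg fun j _ => sq_nonneg _) (by positivity)
  apply negativeSpectralProjection_eq (hΓ.isHermitian_massiveDiracHamiltonian hd b m k)
    (Real.sqrt_pos.mpr hpos)
  rw [Real.sq_sqrt hpos.le, hΓ.massiveDiracHamiltonian_sq hd]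

theorem differentiable_diracProjection (hΓ : IsIrreducibleCliffordRep Γ) (hd : Even d)
    (b : Fin d → ℝ) {m : ℝ} (hm : m ≠ 0) (r s : n) :
    Differentiable ℝ fun k : Fin d → ℝ => diracProjection Γ b m k r s := by
  have hpos : ∀ k : Fin d → ℝ, 0 < ∑ j, (b j * k j) ^ 2 + m ^ 2 := fun k =>
    add_pos_of_nonneg_of_pos (Finset.sum_nonneg fun j _ => sq_nonneg _) (by positivity)
  have h1 : Differentiable ℝ fun k : Fin d → ℝ =>
      (((Real.sqrt (∑ j, (b j * k j) ^ 2 + m ^ 2))⁻¹ : ℝ) : ℂ) := by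
    have : Differentiable ℝ fun k : Fin d → ℝ => (Real.sqrt (∑ j, (b j * k j) ^ 2 + m ^ 2))⁻¹ := by
      refine Differentiable.inv (Differentiable.sqrt (by fun_prop) fun k => (hpos k).ne') ?_
      exact fun k => (Real.sqrt_pos.mpr (hpos k)).ne'
    exact Complex.ofRealCLM.differentiable.comp this
  have h2 : Differentiable ℝ fun k : Fin d → ℝ => massiveDiracHamiltonian Γ b m k r s := by
    simp only [massiveDiracHamiltonian, diracHamiltonian, Matrix.add_apply, Matrix.sum_apply,
      Matrix.smul_apply, smul_eq_mul]
    refine Differentiable.add_const _ (Differentiable.fun_sum fun j _ => ?_)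
    refine Differentiable.mul_const ?_ _
    have : Differentiable ℝ fun k : Fin d → ℝ => b j * k j := by fun_prop
    exact Complex.ofRealCLM.differentiable.comp this
  simp only [hΓ.diracProjection_eq hd b hm, Matrix.smul_apply, Matrix.sub_apply, smul_eq_mul]
  exact (((differentiable_const _).sub (h1.mul h2))).const_mul _

theorem matrixPartialDeriv_diracProjection (hΓ : IsIrreducibleCliffordRep Γ) (hd : Even d)
    (b : Fin d → ℝ) {m : ℝ} (hm : m ≠ 0) (j : Fin d) (k : Fin d → ℝ) {E : ℝ}
    (hE : E = Real.sqrt (∑ j, (b j * k j) ^ 2 + m ^ 2)) :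
    matrixPartialDeriv (diracProjection Γ b m) j k = (-(1 / 2) : ℂ) •
      (((b j / E : ℝ) : ℂ) • Γ j +
        ((-(b j ^ 2 * k j) / E ^ 3 : ℝ) : ℂ) • massiveDiracHamiltonian Γ b m k) := by
  have hpos : 0 < ∑ j, (b j * k j) ^ 2 + m ^ 2 :=
    add_pos_of_nonneg_of_pos (Finset.sum_nonneg fun j _ => sq_nonneg _) (by positivity)
  have hE0 : 0 < E := hE ▸ Real.sqrt_pos.mpr hpos
  have hS : ∀ t : ℝ, ∑ i, (b i * Function.update k j t i) ^ 2 + m ^ 2 =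
      b j ^ 2 * (t ^ 2 - k j ^ 2) + (∑ i, (b i * k i) ^ 2 + m ^ 2) := by
    intro t
    have : ∑ i, (b i * Function.update k j t i) ^ 2 =
        ∑ i, ((b i * k i) ^ 2 + if i = j then b j ^ 2 * (t ^ 2 - k j ^ 2) else 0) := by
      refine Finset.sum_congr rfl fun i _ => ?_
      by_cases hi : i = j
      · subst hi; simp; ring
      · simp [hi]
    rw [this, Finset.sum_add_distrib, Finset.sum_ite_eq']
    simp; ring
  have hH : ∀ t : ℝ, massiveDiracHamiltonian Γ b m (Function.update k j t) =
      ((b j * (t - k j) : ℝ) : ℂ) • Γ j + massiveDiracHamiltonian Γ b m k := by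
    intro t
    unfold massiveDiracHamiltonian diracHamiltonian
    rw [← add_assoc]
    congr 1
    have : ∀ i, ((b i * Function.update k j t i : ℝ) : ℂ) • Γ i =
        (if i = j then ((b j * (t - k j) : ℝ) : ℂ) • Γ j else 0) + ((b i * k i : ℝ) : ℂ) • Γ i := by
      intro i
      by_cases hi : i = j
      · subst hi
        rw [if_pos rfl, ← add_smul, Function.update_self]
        congr 1; push_cast; ring
      · simp [hi]
    rw [Finset.sum_congr rfl fun i _ => this i, Finset.sum_add_distrib, Finset.sum_ite_eq']
    simp
  have hsqrt : HasDerivAt (fun t : ℝ =>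
      (Real.sqrt (b j ^ 2 * (t ^ 2 - k j ^ 2) + (∑ i, (b i * k i) ^ 2 + m ^ 2)))⁻¹)
      (-(b j ^ 2 * k j) / E ^ 3) (k j) := by
    have h1 : HasDerivAt (fun t : ℝ => b j ^ 2 * (t ^ 2 - k j ^ 2) +
        (∑ i, (b i * k i) ^ 2 + m ^ 2)) (b j ^ 2 * (2 * k j)) (k j) := by
      have := (((hasDerivAt_pow 2 (k j)).sub_const (k j ^ 2)).const_mul (b j ^ 2)).add_const
        (∑ i, (b i * k i) ^ 2 + m ^ 2)
      simpa using this
    have hne : b j ^ 2 * (k j ^ 2 - k j ^ 2) + (∑ i, (b i * k i) ^ 2 + m ^ 2) ≠ 0 := by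
      simpa using hpos.ne'
    have h2 := (h1.sqrt hne).fun_inv (by
      rw [sub_self, mul_zero, zero_add, ← hE]; exact hE0.ne')
    refine h2.congr_deriv ?_
    rw [sub_self, mul_zero, zero_add, ← hE]
    field_simp
  ext r s
  have hentry : ∀ t : ℝ, diracProjection Γ b m (Function.update k j t) r s = (1 / 2 : ℂ) *
      ((1 : Matrix n n ℂ) r s - (((Real.sqrt (b j ^ 2 * (t ^ 2 - k j ^ 2) +
        (∑ i, (b i * k i) ^ 2 + m ^ 2)))⁻¹ : ℝ) : ℂ) *
        (((b j * (t - k j) : ℝ) : ℂ) * Γ j r s + massiveDiracHamiltonian Γ b m k r s)) := by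
    intro t
    rw [hΓ.diracProjection_eq hd b hm, hS, hH]
    simp only [Matrix.smul_apply, Matrix.sub_apply, Matrix.add_apply, smul_eq_mul]
  have hlin : HasDerivAt (fun t : ℝ => ((b j * (t - k j) : ℝ) : ℂ)) (b j : ℂ) (k j) := by
    have : HasDerivAt (fun t : ℝ => b j * (t - k j)) (b j) (k j) := by
      simpa using ((hasDerivAt_id (k j)).sub_const (k j)).const_mul (b j)
    exact this.ofReal_comp
  have hder := (((hsqrt.ofReal_comp).mul ((hlin.mul_const (Γ j r s)).add_const
    (massiveDiracHamiltonian Γ b m k r s))).const_sub ((1 : Matrix n n ℂ) r s)).const_mul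
    (1 / 2 : ℂ)
  simp only [matrixPartialDeriv, Matrix.of_apply]
  rw [funext hentry]
  refine hder.deriv.trans ?_
  simp only [sub_self, mul_zero, zero_add, ← hE, Matrix.smul_apply, Matrix.add_apply, smul_eq_mul,
    Complex.ofReal_zero, zero_mul]
  push_cast
  ring

theorem chernDensity_diracProjection (hΓ : IsIrreducibleCliffordRep Γ) (hd : Even d) (hd0 : 0 < d)
    (b : Fin d → ℝ) {m : ℝ} (hm : m ≠ 0) (k : Fin d → ℝ) {E : ℝ}
    (hE : E = Real.sqrt (∑ j, (b j * k j) ^ 2 + m ^ 2)) :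
    chernDensity (diracProjection Γ b m) k =
      -((1 / 2) ^ (d + 1) * d.factorial * (Complex.I ^ (d / 2) * m * 2 ^ (d / 2)) * (∏ j, b j : ℝ)) *
        ((1 / E ^ (d + 1) : ℝ) : ℂ) := by
  have hpos : 0 < ∑ j, (b j * k j) ^ 2 + m ^ 2 :=
    add_pos_of_nonneg_of_pos (Finset.sum_nonneg fun j _ => sq_nonneg _) (by positivity)
  have hE0 : 0 < E := hE ▸ Real.sqrt_pos.mpr hpos
  have hEC : (E : ℂ) ≠ 0 := by exact_mod_cast hE0.ne'
  have hE2 : E ^ 2 = ∑ j, (b j * k j) ^ 2 + m ^ 2 := by rw [hE, Real.sq_sqrt hpos.le]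
  set H := massiveDiracHamiltonian Γ b m k with hH
  set V : Fin d → Matrix n n ℂ := fun j =>
    ((b j / E : ℝ) : ℂ) • Γ j + ((-(b j ^ 2 * k j) / E ^ 3 : ℝ) : ℂ) • H with hV
  have hHH : H * H = ((E ^ 2 : ℝ) : ℂ) • 1 := by
    rw [hH, hΓ.massiveDiracHamiltonian_sq hd, hE2]
  -- The anticommutator of `H` with `Γ j` contributes `2 b_j ^ 2 k_j / E`, which the `H ^ 2 = E ^ 2`
  -- term cancels.
  have hVanti : ∀ j, H * V j = -(V j * H) := by
    intro j
    have h1 := hΓ.mul_massiveDiracHamiltonian_add hd b m k j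
    rw [← hH] at h1
    rw [eq_neg_iff_add_eq_zero]
    have : H * V j + V j * H = ((b j / E : ℝ) : ℂ) • (H * Γ j + Γ j * H) +
        ((2 * (-(b j ^ 2 * k j) / E ^ 3) : ℝ) : ℂ) • (H * H) := by
      simp only [hV, mul_add, add_mul, mul_smul_comm, smul_mul_assoc, smul_add]
      push_cast
      rw [mul_smul, two_smul]
      abel
    rw [this, h1, hHH, smul_smul, smul_smul, ← add_smul]
    convert zero_smul ℂ (1 : Matrix n n ℂ)
    push_cast
    field_simp
    ring
  have hsum : chernDensity (diracProjection Γ b m) k =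
      alternatingTrace d (diracProjection Γ b m k)
        (fun j => matrixPartialDeriv (diracProjection Γ b m) j k) := by
    rw [alternatingTrace_apply]; rfl
  have hlin : ∀ X : Fin d → Matrix n n ℂ, alternatingTrace d (diracProjection Γ b m k) X =
      (1 / 2 : ℂ) * (alternatingTrace d 1 X - ((E⁻¹ : ℝ) : ℂ) * alternatingTrace d H X) := by
    intro X
    simp only [alternatingTrace_apply]
    rw [hΓ.diracProjection_eq hd b hm, ← hE, Finset.mul_sum, ← Finset.sum_sub_distrib,
      Finset.mul_sum]
    refine Finset.sum_congr rfl fun ρ _ => ?_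
    rw [smul_mul_assoc, sub_mul, smul_mul_assoc, Matrix.trace_smul, Matrix.trace_sub,
      Matrix.trace_smul]
    simp only [smul_eq_mul]
    ring
  have hW : alternatingTrace d H V =
      alternatingTrace d H (fun j => ((b j / E : ℝ) : ℂ) • Γ j) := by
    rw [← alternatingTrace_add_smul hd H V hVanti
      (fun j => -((-(b j ^ 2 * k j) / E ^ 3 : ℝ) : ℂ))]
    congr 1
    funext j
    simp only [hV, neg_smul]
    abel
  have hsmul : alternatingTrace d H (fun j => ((b j / E : ℝ) : ℂ) • Γ j) =
      ((∏ j, b j / E : ℝ) : ℂ) * alternatingTrace d H Γ := by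
    rw [(alternatingTrace d H).map_smul_univ (fun j => ((b j / E : ℝ) : ℂ)) Γ, smul_eq_mul]
    push_cast; rfl
  have hscale : alternatingTrace d H (fun j => (-(1 / 2) : ℂ) • V j) =
      (1 / 2) ^ d * alternatingTrace d H V := by
    rw [(alternatingTrace d H).map_smul_univ (fun _ => (-(1 / 2) : ℂ)) V, smul_eq_mul]
    simp [hd.neg_pow]
  rw [hsum, funext fun j => hΓ.matrixPartialDeriv_diracProjection hd b hm j k hE, hlin,
    alternatingTrace_one hd hd0, hscale, hW, hsmul, alternatingTrace_eq_factorial _ _ hΓ.anticomm,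
    hH, hΓ.trace_massiveDiracHamiltonian_mul_prod hd, Finset.prod_div_distrib]
  simp only [Finset.prod_const, Finset.card_univ, Fintype.card_fin]
  push_cast
  field_simp
  ring

end IsIrreducibleCliffordRep

/-! ### Evaluation of the Chern integral -/

theorem proposition6p3 {d : ℕ} (hd : Even d) (hd0 : 0 < d)
    {n : Type*} [Fintype n] [DecidableEq n]
    (Γ : Fin d → Matrix n n ℂ) (hΓ : IsIrreducibleCliffordRep Γ)
    (b : Fin d → ℝ) (m : ℝ) (hm : m ≠ 0) :
    (∀ r s, Differentiable ℝ fun k : Fin d → ℝ => diracProjection Γ b m k r s) ∧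
    MeasureTheory.Integrable (chernDensity (diracProjection Γ b m)) ∧
    chernIntegral (diracProjection Γ b m) =
      ((1 / 2 * (-1) ^ (d / 2 + 1) * (∏ j, Real.sign (b j)) * Real.sign m : ℝ) : ℂ) := by
  refine ⟨hΓ.differentiable_diracProjection hd b hm, ?_⟩
  have hdens := fun k => hΓ.chernDensity_diracProjection hd hd0 b hm k rfl
  -- If some `b j` vanishes, the Gaussian formula is unavailable, but the density carries the factor
  -- `∏ b j` and is identically zero.
  by_cases hb : ∃ j, b j = 0
  · obtain ⟨j, hj⟩ := hb
    have hB : ∏ j, b j = 0 := Finset.prod_eq_zero (Finset.mem_univ j) hj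
    have hS : ∏ j, Real.sign (b j) = 0 :=
      Finset.prod_eq_zero (Finset.mem_univ j) (by rw [hj, Real.sign_zero])
    have hz : chernDensity (diracProjection Γ b m) = fun _ => 0 := by
      funext k
      rw [hdens, hB]; simp
    rw [chernIntegral, hz, hS]
    simp
  · push Not at hb
    obtain ⟨p, rfl⟩ := hd
    have hp2 : (p + p) / 2 = p := by omega
    obtain ⟨hint, hval⟩ := integral_rpow_neg_add_half b hb hm
    have hpow : ∀ k : Fin (p + p) → ℝ,
        1 / Real.sqrt (∑ j, (b j * k j) ^ 2 + m ^ 2) ^ (p + p + 1) =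
        (1 / (∑ j, (b j * k j) ^ 2 + m ^ 2)) ^ ((p : ℝ) + 1 / 2) := by
      intro k
      have hpos : 0 < ∑ j, (b j * k j) ^ 2 + m ^ 2 :=
        add_pos_of_nonneg_of_pos (Finset.sum_nonneg fun j _ => sq_nonneg _) (by positivity)
      rw [Real.sqrt_eq_rpow, ← Real.rpow_natCast, ← Real.rpow_mul hpos.le,
        Real.div_rpow zero_le_one hpos.le, Real.one_rpow]
      congr 2
      push_cast; ring
    simp only [hpow, hp2] at hdens
    have hsgn : ∀ x : ℝ, x ≠ 0 → Real.sign x = x / |x| := by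
      intro x hx
      rcases lt_or_gt_of_ne hx with h | h
      · rw [Real.sign_of_neg h, abs_of_neg h, div_neg, div_self hx]
      · rw [Real.sign_of_pos h, abs_of_pos h, div_self hx]
    have hB : (∏ j, b j) ≠ 0 := Finset.prod_ne_zero_iff.mpr fun j _ => hb j
    have hS : ∏ j, Real.sign (b j) = (∏ j, b j) / |∏ j, b j| := by
      rw [Finset.abs_prod, ← Finset.prod_div_distrib]
      exact Finset.prod_congr rfl fun j _ => hsgn _ (hb j)
    rw [funext hdens]
    refine ⟨hint.ofReal.const_mul _, ?_⟩
    unfold chernIntegral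
    rw [MeasureTheory.integral_div, funext hdens, MeasureTheory.integral_const_mul,
      integral_complex_ofReal, hval, hS, hsgn m hm, hp2]
    have hG : 0 < Real.Gamma ((p : ℝ) + 1 / 2) := Real.Gamma_pos_of_pos (by positivity)
    have hfac := factorial_two_mul_eq p
    set G := Real.Gamma ((p : ℝ) + 1 / 2)
    set B := ∏ j, b j
    have hval2 : Real.pi ^ p * Real.sqrt Real.pi / (G * |m| * |B|) * (p + p).factorial =
        Real.pi ^ p * 4 ^ p * p.factorial / (|m| * |B|) := by
      have : |m| ≠ 0 := abs_ne_zero.mpr hm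
      have : |B| ≠ 0 := abs_ne_zero.mpr hB
      field_simp
      linear_combination hfac
    have hval3 := congrArg (fun x : ℝ => (x : ℂ)) hval2
    simp only [Complex.ofReal_mul, Complex.ofReal_natCast] at hval3
    -- One power comes from the prefactor, the other from the chirality trace; the extra minus sign
    -- in the result is that of `H` in `P`.
    have hI : (Complex.I : ℂ) ^ p * Complex.I ^ p = (-1) ^ p := by rw [← mul_pow]; simp
    have hpi : (Real.pi : ℂ) ≠ 0 := by exact_mod_cast Real.pi_ne_zero
    have hmC : ((|m| : ℝ) : ℂ) ≠ 0 := by exact_mod_cast abs_ne_zero.mpr hm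
    have hBC : ((|B| : ℝ) : ℂ) ≠ 0 := by exact_mod_cast abs_ne_zero.mpr hB
    have hpf : (p.factorial : ℂ) ≠ 0 := by exact_mod_cast p.factorial_ne_zero
    set Z : ℂ := ((Real.pi ^ p * Real.sqrt Real.pi / (G * |m| * |B|) : ℝ) : ℂ)
    calc (2 * Complex.I * (Real.pi : ℂ)) ^ p / (p.factorial : ℂ) *
        (-((1 / 2) ^ (p + p + 1) * ((p + p).factorial : ℂ) * (Complex.I ^ p * m * 2 ^ p) *
          (B : ℂ)) * Z / (2 * (Real.pi : ℂ)) ^ (p + p))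
        = -((2 * Complex.I * (Real.pi : ℂ)) ^ p / (p.factorial : ℂ) *
        ((1 / 2) ^ (p + p + 1) * (Complex.I ^ p * m * 2 ^ p) *
          (B : ℂ)) * (Z * ((p + p).factorial : ℂ)) / (2 * (Real.pi : ℂ)) ^ (p + p)) := by ring
      _ = -(1 / 2 * (Complex.I ^ p * Complex.I ^ p) * (B / ((|B| : ℝ) : ℂ)) *
          (m / ((|m| : ℝ) : ℂ))) := by
        rw [hval3]
        have h4 : (4 : ℂ) ^ p = 2 ^ p * 2 ^ p := by rw [← mul_pow]; norm_num
        push_cast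
        simp only [mul_pow, pow_add, pow_one, h4, one_div, inv_pow]
        field_simp
      _ = _ := by
        rw [hI]
        push_cast
        ring
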